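/- Boolean PCF with algebraic effects ($\mathrm{BPCF}_{\mathrm{AE}}$) is the following call-by-value simply typed language. Types are $\tau ::= b \mid \tau_1\to\tau_2$ with base types $b ::= \mathsf{unit}\mid\mathsf{bool}$. Fix a finite set of algebraic effects $\alpha_1,\dots,\alpha_\ell$ and a type assignment $\mathcal A(\alpha_i)=b_i\to b_i'$ with $b_i,b_i'$ base types. Expressions are $$M ::= \mathtt{fail}\mid V\mid x\mid M_1M_2\mid Y(\lambda f.\lambda x.M)\mid \mathtt{if}\ M_0\ \mathtt{then}\ M_1\ \mathtt{else}\ M_2\mid \alpha(W_1;W_2)\mid \mathtt{handle}\ M\ \mathtt{with}\ H,$$ where $V ::= ()\mid\mathtt{true}\mid\mathtt{false}\mid\lambda x.M$ ranges over values, $W_1,W_2$ are values or variables, and $H=\{\mathtt{return}\,x\mapsto M_0,\ \alpha_1(x;c)\mapsto M_1,\dots,\alpha_\ell(x;c)\mapsto M_\ell\}$ has one clause for each effect. *Typing.* The rules are the usual ones of simply typed $\lambda$-calculus with recursion and Booleans; $\mathtt{fail}$ has every type; $\Gamma\vdash\alpha_i(W_1;W_2):\tau$ if $\Gamma\vdash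 W_1:b_i$ and $\Gamma\vdash W_2:b_i'\to\tau$; and $\Gamma\vdash\mathtt{handle}\ M\ \mathtt{with}\ H:\tau_2$ if, for some $\tau_1$, $\Gamma\vdash M:\tau_1$, $\Gamma,x{:}\tau_1\vdash M_0:\tau_2$, and $\Gamma,x{:}b_i,c{:}b_i'\to\rho\vdash M_i:\tau_2$ for every $i$, where $\rho=\tau_2$ for deep handlers and $\rho=\tau_1$ for shallow handlers. *Reduction.* Evaluation contexts are $E ::= [\,]\mid E\,M\mid V\,E\mid \mathtt{if}\ E\ \mathtt{then}\ M_1\ \mathtt{else}\ M_2\mid\alpha(E;V)\mid\mathtt{handle}\ E\ \mathtt{with}\ H$, and $F$ ranges over those evaluation contexts whose hole is not inside a $\mathtt{handle}$ of $F$. The steps are $E[\mathtt{fail}]\to\mathtt{fail}$, the usual steps for $\beta_V$ and conditionals, $E[Y(\lambda f.\lambda x.M)]\to E[\lambda x.[Y(\lambda f.\lambda x.M)/f]M]$, $E[\mathtt{handle}\ V\ \mathtt{with}\ H]\to E[[V/x]M_0]$, and $$E[\mathtt{handle}\ F[\alpha_i(V_1;V_2)]\ \mathtt{with}\ H]\to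 E[[V_1/x,K/c]M_i],$$ where $K=\lambda y.\,\mathtt{handle}\ F[V_2\,y]\ \mathtt{with}\ H$ in the deep handler semantics and $K=\lambda y.\,F[V_2\,y]$ in the shallow handler semantics ($y$ fresh). The *reachability problem* is to decide, given a closed expression $M$ with $\vdash M:b$ for some base type $b$, whether $M\to^*\mathtt{fail}$. **Theorem.** The reachability problem for $\mathrm{BPCF}_{\mathrm{AE}}$ is undecidable both for shallow and for deep handlers. More precisely: 1. for every signature $(\alpha_1,\dots,\alpha_\ell;\mathcal A)$ with at least two distinct effects of type $\mathsf{unit}\to\mathsf{unit}$, the reachability problem under shallow handlers is undecidable; 2. for every signature $(\alpha_1,\dots,\alpha_\ell;\mathcal A)$ with at least four distinct effects of type $\mathsf{unit}\to\mathsf{unit}$, the reachability problem under deep handlers is undecidable. -/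

import Mathlib

/-! Boolean PCF with algebraic effects on base types: syntax (with de Bruijn indices), Curry-style
typing, call-by-value semantics, and the reachability problem. -/

namespace BPCFAE

/-- Base types. -/
inductive BaseTy : Type
  | unit
  | bool

/-- Simple types. -/
inductive Ty : Type
  | base (b : BaseTy)
  | arrow (σ τ : Ty)

/-- The two semantics of effect handlers. -/
inductive Mode : Type
  | shallow
  | deep

/-- A signature with `n` algebraic effects: `A α = (b₁, b₂)` means that the effect `α` is an
operation from `b₁` to `b₂`. -/
abbrev Sig (n : ℕ) : Type := Fin n → BaseTy × BaseTy

/-- Expressions over the effect names `Fin n`. Variables are de Bruijn indices.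
* `lam M`: `M` binds the parameter as index `0`.
* `fix M` is the recursive function `Y (λ f. λ x. M)`: `x` is index `0` and `f` is index `1`.
* `op α V₁ V₂` is the invocation `α(V₁; V₂)` with operand `V₁` and continuation `V₂`.
* `handle M M₀ H` is `handle M with {return x ↦ M₀, α₁(x; c) ↦ H α₁, …, αₙ(x; c) ↦ H αₙ}`;
  in `M₀`, `x` is index `0`; in `H α`, `c` is index `0` and `x` is index `1`. -/
inductive Term (n : ℕ) : Type
  | fail
  | var (i : ℕ)
  | unit
  | tt
  | ff
  | lam (M : Term n)
  | app (M N : Term n)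
  | fix (M : Term n)
  | ite (M₀ M₁ M₂ : Term n)
  | op (α : Fin n) (V₁ V₂ : Term n)
  | handle (M M₀ : Term n) (H : Fin n → Term n)

namespace Term

variable {n : ℕ}

/-- Values. -/
inductive IsValue : Term n → Prop
  | unit : IsValue unit
  | tt : IsValue tt
  | ff : IsValue ff
  | lam (M : Term n) : IsValue (lam M)

/-- The expressions that may be written as the arguments of an effect invocation:
values and variables. -/
inductive IsArg : Term n → Prop
  | val {V : Term n} : IsValue V → IsArg V
  | var (i : ℕ) : IsArg (var i)

/-- Lifting of a renaming under one binder. -/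
def liftRen (ξ : ℕ → ℕ) : ℕ → ℕ
  | 0 => 0
  | i + 1 => ξ i + 1

/-- Renaming of free variables. -/
def rename (ξ : ℕ → ℕ) : Term n → Term n
  | fail => fail
  | var i => var (ξ i)
  | unit => unit
  | tt => tt
  | ff => ff
  | lam M => lam (rename (liftRen ξ) M)
  | app M N => app (rename ξ M) (rename ξ N)
  | fix M => fix (rename (liftRen (liftRen ξ)) M)
  | ite M₀ M₁ M₂ => ite (rename ξ M₀) (rename ξ M₁) (rename ξ M₂)
  | op α V₁ V₂ => op α (rename ξ V₁) (rename ξ V₂)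
  | handle M M₀ H =>
      handle (rename ξ M) (rename (liftRen ξ) M₀) (fun α => rename (liftRen (liftRen ξ)) (H α))

/-- Lifting of a substitution under one binder. -/
def liftSub (s : ℕ → Term n) : ℕ → Term n
  | 0 => var 0
  | i + 1 => rename Nat.succ (s i)

/-- Simultaneous capture-avoiding substitution. -/
def subst (s : ℕ → Term n) : Term n → Term n
  | fail => fail
  | var i => s i
  | unit => unit
  | tt => tt
  | ff => ff
  | lam M => lam (subst (liftSub s) M)
  | app M N => app (subst s M) (subst s N)
  | fix M => fix (subst (liftSub (liftSub s)) M)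
  | ite M₀ M₁ M₂ => ite (subst s M₀) (subst s M₁) (subst s M₂)
  | op α V₁ V₂ => op α (subst s V₁) (subst s V₂)
  | handle M M₀ H =>
      handle (subst s M) (subst (liftSub s) M₀) (fun α => subst (liftSub (liftSub s)) (H α))

/-- The substitution replacing index `0` by `N` and lowering all other indices by one. -/
def single (N : Term n) : ℕ → Term n
  | 0 => N
  | i + 1 => var i

/-- The substitution replacing index `0` by `K`, index `1` by `N`, and lowering all other indices
by two. -/
def double (K N : Term n) : ℕ → Term n
  | 0 => K
  | 1 => N
  | i + 2 => var i

/-- A Gödel numbering of expressions, built from the pairing function on `ℕ`. -/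
def code : Term n → ℕ
  | fail => Nat.pair 0 0
  | var i => Nat.pair 1 i
  | unit => Nat.pair 2 0
  | tt => Nat.pair 3 0
  | ff => Nat.pair 4 0
  | lam M => Nat.pair 5 (code M)
  | app M N => Nat.pair 6 (Nat.pair (code M) (code N))
  | fix M => Nat.pair 7 (code M)
  | ite M₀ M₁ M₂ => Nat.pair 8 (Nat.pair (code M₀) (Nat.pair (code M₁) (code M₂)))
  | op α V₁ V₂ => Nat.pair 9 (Nat.pair α (Nat.pair (code V₁) (code V₂)))
  | handle M M₀ H =>
      Nat.pair 10 (Nat.pair (code M) (Nat.pair (code M₀)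
        (Encodable.encode (List.ofFn fun α => code (H α)))))

/-- Distinct expressions have distinct codes. -/
theorem code_injective : Function.Injective (code : Term n → ℕ) := by
  intro M
  induction M with
  | handle M M₀ H ihM ih₀ ihH =>
    intro N h
    cases N <;> simp only [code, Nat.pair_eq_pair, Encodable.encode_inj, List.ofFn_inj] at h <;>
      try omega
    obtain ⟨-, h₁, h₂, h₃⟩ := h
    rw [ihM h₁, ih₀ h₂]
    congr
    funext α
    exact ihH α (congrFun h₃ α)
  | _ =>
    intro N h
    cases N <;> simp only [code, Nat.pair_eq_pair, Fin.val_inj] at h <;> grind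

end Term

open Term

/-- The typing judgment `Γ ⊢ M : σ`. Index `i` of `M` has the type at position `i` of `Γ`.
The two modes differ only in the type of the continuation in a handler. -/
inductive HasType {n : ℕ} (m : Mode) (A : Sig n) : List Ty → Term n → Ty → Prop
  | fail {Γ : List Ty} {σ : Ty} : HasType m A Γ fail σ
  | var {Γ : List Ty} {i : ℕ} {σ : Ty} : Γ[i]? = some σ → HasType m A Γ (var i) σ
  | unit {Γ : List Ty} : HasType m A Γ unit (.base .unit)
  | tt {Γ : List Ty} : HasType m A Γ tt (.base .bool)
  | ff {Γ : List Ty} : HasType m A Γ ff (.base .bool)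
  | lam {Γ : List Ty} {M : Term n} {σ τ : Ty} :
      HasType m A (σ :: Γ) M τ → HasType m A Γ (lam M) (.arrow σ τ)
  | app {Γ : List Ty} {M N : Term n} {σ τ : Ty} :
      HasType m A Γ M (.arrow σ τ) → HasType m A Γ N σ → HasType m A Γ (app M N) τ
  | fix {Γ : List Ty} {M : Term n} {σ τ : Ty} :
      HasType m A (σ :: .arrow σ τ :: Γ) M τ → HasType m A Γ (fix M) (.arrow σ τ)
  | ite {Γ : List Ty} {M₀ M₁ M₂ : Term n} {σ : Ty} :
      HasType m A Γ M₀ (.base .bool) → HasType m A Γ M₁ σ → HasType m A Γ M₂ σ →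
      HasType m A Γ (ite M₀ M₁ M₂) σ
  | op {Γ : List Ty} {α : Fin n} {V₁ V₂ : Term n} {σ : Ty} :
      IsArg V₁ → IsArg V₂ →
      HasType m A Γ V₁ (.base (A α).1) → HasType m A Γ V₂ (.arrow (.base (A α).2) σ) →
      HasType m A Γ (op α V₁ V₂) σ
  | handle {Γ : List Ty} {M M₀ : Term n} {H : Fin n → Term n} {σ₁ σ₂ : Ty} :
      HasType m A (σ₁ :: Γ) M₀ σ₂ →
      (∀ α, HasType m A
        (.arrow (.base (A α).2) (match m with | .deep => σ₂ | .shallow => σ₁) ::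
          .base (A α).1 :: Γ) (H α) σ₂) →
      HasType m A Γ M σ₁ →
      HasType m A Γ (handle M M₀ H) σ₂

/-- One-hole contexts whose hole is not under a binder. -/
inductive Ctx (n : ℕ) : Type
  | hole
  | appL (E : Ctx n) (M : Term n)
  | appR (V : Term n) (E : Ctx n)
  | ite (E : Ctx n) (M₁ M₂ : Term n)
  | op (α : Fin n) (E : Ctx n) (V : Term n)
  | handle (E : Ctx n) (M₀ : Term n) (H : Fin n → Term n)

namespace Ctx

variable {n : ℕ}

/-- `E.plug M` is `E[M]`. -/
def plug : Ctx n → Term n → Term n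
  | hole, M => M
  | appL E N, M => .app (plug E M) N
  | appR V E, M => .app V (plug E M)
  | ite E M₁ M₂, M => .ite (plug E M) M₁ M₂
  | op α E V, M => .op α (plug E M) V
  | handle E M₀ H, M => .handle (plug E M) M₀ H

/-- Renaming of the free variables of a context. -/
def rename (ξ : ℕ → ℕ) : Ctx n → Ctx n
  | hole => hole
  | appL E M => appL (rename ξ E) (M.rename ξ)
  | appR V E => appR (V.rename ξ) (rename ξ E)
  | ite E M₁ M₂ => ite (rename ξ E) (M₁.rename ξ) (M₂.rename ξ)
  | op α E V => op α (rename ξ E) (V.rename ξ)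
  | handle E M₀ H =>
      handle (rename ξ E) (M₀.rename (liftRen ξ)) (fun α => (H α).rename (liftRen (liftRen ξ)))

/-- Evaluation contexts `E`. -/
inductive IsEval : Ctx n → Prop
  | hole : IsEval hole
  | appL {E : Ctx n} {M : Term n} : IsEval E → IsEval (appL E M)
  | appR {V : Term n} {E : Ctx n} : IsValue V → IsEval E → IsEval (appR V E)
  | ite {E : Ctx n} {M₁ M₂ : Term n} : IsEval E → IsEval (ite E M₁ M₂)
  | op {α : Fin n} {E : Ctx n} {V : Term n} : IsEval E → IsValue V → IsEval (op α E V)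
  | handle {E : Ctx n} {M₀ : Term n} {H : Fin n → Term n} : IsEval E → IsEval (handle E M₀ H)

/-- The hole of the context is not enclosed by a handler of the context. -/
def NoHandler : Ctx n → Prop
  | hole => True
  | appL E _ => NoHandler E
  | appR _ E => NoHandler E
  | ite E _ _ => NoHandler E
  | op _ E _ => NoHandler E
  | handle _ _ _ => False

end Ctx

/-- The continuation passed to the handler `{M₀, H}` of `F[α(V₁; V₂)]`: `λ y. F[V₂ y]` for shallow
handlers, and `λ y. handle F[V₂ y] with {M₀, H}` for deep handlers. The free variables of `F`, `V₂`,
`M₀` and `H` are renamed because they are moved under the binder of `y`. -/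
def resumption {n : ℕ} (m : Mode) (F : Ctx n) (V₂ M₀ : Term n) (H : Fin n → Term n) : Term n :=
  let body : Term n := (F.rename Nat.succ).plug (app (V₂.rename Nat.succ) (var 0))
  match m with
  | .shallow => lam body
  | .deep =>
      lam (handle body (M₀.rename (liftRen Nat.succ))
        (fun α => (H α).rename (liftRen (liftRen Nat.succ))))

/-- Contraction of redexes. -/
inductive Contract {n : ℕ} (m : Mode) : Term n → Term n → Prop
  | beta {M V : Term n} : IsValue V → Contract m (app (lam M) V) (M.subst (single V))
  | iteTrue {M₁ M₂ : Term n} : Contract m (ite tt M₁ M₂) M₁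
  | iteFalse {M₁ M₂ : Term n} : Contract m (ite ff M₁ M₂) M₂
  | fix {M : Term n} : Contract m (fix M) (lam (M.subst (liftSub (single (fix M)))))
  | ret {V M₀ : Term n} {H : Fin n → Term n} :
      IsValue V → Contract m (handle V M₀ H) (M₀.subst (single V))
  | eff {F : Ctx n} {α : Fin n} {V₁ V₂ M₀ : Term n} {H : Fin n → Term n} :
      F.IsEval → F.NoHandler → IsValue V₁ → IsValue V₂ →
      Contract m (handle (F.plug (op α V₁ V₂)) M₀ H)
        ((H α).subst (double (resumption m F V₂ M₀ H) V₁))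

/-- The one-step reduction relation. -/
inductive Red {n : ℕ} (m : Mode) : Term n → Term n → Prop
  | step {E : Ctx n} {M N : Term n} :
      E.IsEval → Contract m M N → Red m (E.plug M) (E.plug N)
  | fail {E : Ctx n} : E.IsEval → Red m (E.plug fail) fail

/-- `M` reduces to `fail` in finitely many steps. -/
def Reaches {n : ℕ} (m : Mode) (M : Term n) : Prop :=
  Relation.ReflTransGen (Red m) M fail

/-- The reachability problem is decidable: some algorithm, given the code of a closed expression `M`
of base type, terminates and answers whether `M` reaches `fail`. Nothing is required of the
algorithm on other inputs. -/
def ReachabilityDecidable {n : ℕ} (m : Mode) (A : Sig n) : Prop :=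
  ∃ f : ℕ →. Bool, Partrec f ∧
    ∀ M : Term n, (∃ b : BaseTy, HasType m A [] M (.base b)) →
      ∃ r ∈ f M.code, (r = true ↔ Reaches m M)

end BPCFAE

/-! One effect makes handlers strong enough for all of arithmetic. The number `k` is a thunk that
performs a fixed effect `k` times. A handler tests for zero by seeing whether the thunk performs any
effect, and takes the predecessor by dropping the first effect. A shallow handler does so by
returning the continuation. A deep handler, which also sees all later effects, folds the thunk into
a function of type `bool → unit` that performs the effects again; called with `true`, it skips the
first one. With recursion, and with vectors as functions from indices to entries, this realizes
every primitive recursive function.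

A program halts if and only if the primitive recursive evaluation with bounded resources succeeds
for some bound. An unbounded search fails once it finds such a bound, and otherwise it runs forever;
then, reduction being deterministic, `fail` is not reached. -/

namespace BPCFAE

open Term

namespace Term

variable {n : ℕ}

theorem liftSub_comp_liftRen (s : ℕ → Term n) (ξ : ℕ → ℕ) :
    liftSub s ∘ liftRen ξ = liftSub (s ∘ ξ) := by
  funext i; cases i <;> rfl

theorem subst_rename (M : Term n) (ξ : ℕ → ℕ) (s : ℕ → Term n) :
    (M.rename ξ).subst s = M.subst (s ∘ ξ) := by
  induction M generalizing ξ s <;> simp_all only [rename, subst, liftSub_comp_liftRen,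
    Function.comp_apply]

theorem liftSub_var_comp (ξ : ℕ → ℕ) :
    liftSub (var ∘ ξ) = (var ∘ liftRen ξ : ℕ → Term n) := by
  funext i; cases i <;> rfl

theorem rename_eq_subst (M : Term n) (ξ : ℕ → ℕ) : M.rename ξ = M.subst (var ∘ ξ) := by
  induction M generalizing ξ <;> simp_all only [rename, subst, liftSub_var_comp,
    Function.comp_apply]

theorem liftSub_var : liftSub var = (var : ℕ → Term n) := by
  funext i; cases i <;> rfl

theorem subst_var (M : Term n) : M.subst var = M := by
  induction M <;> simp_all only [subst, liftSub_var]

theorem single_comp_succ (N : Term n) : single N ∘ Nat.succ = var := rfl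

@[simp]
theorem rename_succ_subst_single (M N : Term n) : (M.rename Nat.succ).subst (single N) = M :=
  (subst_rename _ _ _).trans (subst_var M)

@[simp]
theorem rename_succ_succ_subst_liftSub_single (M N : Term n) :
    ((M.rename Nat.succ).rename Nat.succ).subst (liftSub (single N)) = M.rename Nat.succ := by
  rw [subst_rename, subst_rename, rename_eq_subst]
  rfl

@[simp] theorem liftSub_zero (s : ℕ → Term n) : liftSub s 0 = var 0 := rfl

@[simp] theorem liftSub_one (s : ℕ → Term n) : liftSub s 1 = (s 0).rename Nat.succ := rfl

@[simp] theorem liftSub_two (s : ℕ → Term n) : liftSub s 2 = (s 1).rename Nat.succ := rfl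

@[simp] theorem single_zero (N : Term n) : single N 0 = N := rfl

@[simp] theorem double_zero (K N : Term n) : double K N 0 = K := rfl

end Term

section Typing

variable {n : ℕ} {m : Mode} {A : Sig n} {Γ : List Ty} {M : Term n} {σ : Ty}

theorem HasType.append (h : HasType m A Γ M σ) (Δ : List Ty) : HasType m A (Γ ++ Δ) M σ := by
  induction h with
  | fail => exact .fail
  | var h =>
    refine .var ?_
    rw [List.getElem?_append_left (List.getElem?_eq_some_iff.1 h).1, h]
  | unit => exact .unit
  | tt => exact .tt
  | ff => exact .ff
  | lam _ ih => exact .lam ih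
  | app _ _ ih₁ ih₂ => exact .app ih₁ ih₂
  | fix _ ih => exact .fix ih
  | ite _ _ _ ih₀ ih₁ ih₂ => exact .ite ih₀ ih₁ ih₂
  | op h₁ h₂ _ _ ih₁ ih₂ => exact .op h₁ h₂ ih₁ ih₂
  | handle _ _ _ ih₀ ihH ih => exact .handle ih₀ ihH ih

theorem HasType.weaken (h : HasType m A [] M σ) (Γ : List Ty) : HasType m A Γ M σ :=
  h.append Γ

theorem liftSub_eq_var {k : ℕ} {s : ℕ → Term n} (hs : ∀ i < k, s i = var i) :
    ∀ i < k + 1, liftSub s i = var i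
  | 0, _ => rfl
  | i + 1, hi => by rw [liftSub, hs i (by lia), rename]

theorem HasType.subst_eq_self (h : HasType m A Γ M σ) {s : ℕ → Term n}
    (hs : ∀ i < Γ.length, s i = .var i) : M.subst s = M := by
  induction h generalizing s with
  | var h => exact hs _ (List.getElem?_eq_some_iff.1 h).1
  | fail | unit | tt | ff => rfl
  | lam _ ih => rw [subst, ih (liftSub_eq_var hs)]
  | app _ _ ih₁ ih₂ => rw [subst, ih₁ hs, ih₂ hs]
  | fix _ ih => rw [subst, ih (liftSub_eq_var (liftSub_eq_var hs))]
  | ite _ _ _ ih₀ ih₁ ih₂ => rw [subst, ih₀ hs, ih₁ hs, ih₂ hs]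
  | op _ _ _ _ ih₁ ih₂ => rw [subst, ih₁ hs, ih₂ hs]
  | handle _ _ _ ih₀ ihH ih =>
    simp only [subst, ih hs, ih₀ (liftSub_eq_var hs), ihH _ (liftSub_eq_var (liftSub_eq_var hs))]

theorem HasType.closed_subst (h : HasType m A [] M σ) (s : ℕ → Term n) : M.subst s = M :=
  h.subst_eq_self (by simp)

end Typing

section UniqueDecomposition

variable {n : ℕ}

namespace Ctx

/-- Composition of contexts: `E.comp E'` is `E[E']`. -/
def comp : Ctx n → Ctx n → Ctx n
  | hole, E' => E'
  | appL E N, E' => appL (comp E E') N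
  | appR V E, E' => appR V (comp E E')
  | ite E M₁ M₂, E' => ite (comp E E') M₁ M₂
  | op α E V, E' => op α (comp E E') V
  | handle E M₀ H, E' => handle (comp E E') M₀ H

theorem plug_comp (E E' : Ctx n) (M : Term n) : (E.comp E').plug M = E.plug (E'.plug M) := by
  induction E <;> simp_all only [comp, plug]

theorem IsEval.comp {E E' : Ctx n} (h : E.IsEval) (h' : E'.IsEval) : (E.comp E').IsEval := by
  induction h with
  | hole => exact h'
  | appL _ ih => exact .appL ih
  | appR hV _ ih => exact .appR hV ih
  | ite _ ih => exact .ite ih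
  | op _ hV ih => exact .op ih hV
  | handle _ ih => exact .handle ih

theorem not_noHandler_comp_handle (E F : Ctx n) (M₀ : Term n) (H : Fin n → Term n) :
    ¬ (E.comp (handle F M₀ H)).NoHandler := by
  induction E <;> simp_all only [comp, NoHandler, not_false_eq_true]

theorem comp_handle_inj {E E' F F' : Ctx n} {M₀ M₀' : Term n} {H H' : Fin n → Term n}
    (hF : F.NoHandler) (hF' : F'.NoHandler)
    (h : E.comp (handle F M₀ H) = E'.comp (handle F' M₀' H')) :
    E = E' ∧ F = F' ∧ M₀ = M₀' ∧ H = H' := by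
  induction E generalizing E' <;> cases E' <;> grind [comp, not_noHandler_comp_handle]

end Ctx

/-- Potential redexes: the expressions that fill the hole of the evaluation context in the unique
decomposition of a reducible expression. An effect invocation is one of them, in place of the
redex formed by its innermost enclosing handler. -/
inductive IsPotentialRedex : Term n → Prop
  | fail : IsPotentialRedex .fail
  | beta {M V : Term n} : IsValue V → IsPotentialRedex (.app (.lam M) V)
  | iteTrue {M₁ M₂ : Term n} : IsPotentialRedex (.ite .tt M₁ M₂)
  | iteFalse {M₁ M₂ : Term n} : IsPotentialRedex (.ite .ff M₁ M₂)
  | fix {M : Term n} : IsPotentialRedex (.fix M)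
  | ret {V M₀ : Term n} {H : Fin n → Term n} : IsValue V → IsPotentialRedex (.handle V M₀ H)
  | op {α : Fin n} {V₁ V₂ : Term n} : IsValue V₁ → IsValue V₂ → IsPotentialRedex (.op α V₁ V₂)

theorem IsPotentialRedex.not_isValue_plug {R : Term n} (hR : IsPotentialRedex R) (E : Ctx n) :
    ¬ IsValue (E.plug R) := by
  intro h
  cases E
  case hole => cases hR <;> cases h
  all_goals cases h

theorem IsPotentialRedex.eq_hole {R R' : Term n} (hR : IsPotentialRedex R)
    (hR' : IsPotentialRedex R') {E : Ctx n} (h : R = E.plug R') : E = .hole := by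
  have hE (E : Ctx n) : ¬ IsValue (E.plug R') := hR'.not_isValue_plug E
  cases hR <;> cases E <;> grind [Ctx.plug, IsValue]

theorem IsPotentialRedex.plug_inj {R R' : Term n} (hR : IsPotentialRedex R)
    (hR' : IsPotentialRedex R') {E E' : Ctx n} (hE : E.IsEval) (hE' : E'.IsEval)
    (h : E.plug R = E'.plug R') : E = E' ∧ R = R' := by
  have hV (E : Ctx n) : ¬ IsValue (E.plug R) := hR.not_isValue_plug E
  have hV' (E : Ctx n) : ¬ IsValue (E.plug R') := hR'.not_isValue_plug E
  induction hE generalizing E' with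
  | hole =>
    obtain rfl := hR.eq_hole hR' h
    exact ⟨rfl, h⟩
  | _ =>
    cases hE' with
    | hole => cases hR'.eq_hole hR h.symm
    | _ => grind [Ctx.plug]

end UniqueDecomposition

section Determinism

variable {n : ℕ} {m : Mode}

/-- `Next m E R N`: the expression `E[R]`, where `R` is a potential redex, reduces to `N`. In the
rule `op`, the handler that captures the effect is a part of the context. -/
inductive Next (m : Mode) : Ctx n → Term n → Term n → Prop
  | fail {E : Ctx n} : Next m E .fail .fail
  | beta {E : Ctx n} {M V : Term n} :
      IsValue V → Next m E (.app (.lam M) V) (E.plug (M.subst (single V)))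
  | iteTrue {E : Ctx n} {M₁ M₂ : Term n} : Next m E (.ite .tt M₁ M₂) (E.plug M₁)
  | iteFalse {E : Ctx n} {M₁ M₂ : Term n} : Next m E (.ite .ff M₁ M₂) (E.plug M₂)
  | fix {E : Ctx n} {M : Term n} :
      Next m E (.fix M) (E.plug (.lam (M.subst (liftSub (single (.fix M))))))
  | ret {E : Ctx n} {V M₀ : Term n} {H : Fin n → Term n} :
      IsValue V → Next m E (.handle V M₀ H) (E.plug (M₀.subst (single V)))
  | op {C E F : Ctx n} {α : Fin n} {V₁ V₂ M₀ : Term n} {H : Fin n → Term n} :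
      C = E.comp (.handle F M₀ H) → F.NoHandler → IsValue V₁ → IsValue V₂ →
      Next m C (.op α V₁ V₂) (E.plug ((H α).subst (double (resumption m F V₂ M₀ H) V₁)))

theorem Next.isPotentialRedex {E : Ctx n} {R N : Term n} (h : Next m E R N) :
    IsPotentialRedex R := by
  cases h <;> constructor <;> assumption

theorem Next.unique {E : Ctx n} {R N N' : Term n} (h : Next m E R N) (h' : Next m E R N') :
    N = N' := by
  cases h with
  | op hC hF =>
    cases h' with
    | op hC' hF' =>
      obtain ⟨rfl, rfl, rfl, rfl⟩ := Ctx.comp_handle_inj hF hF' (hC.symm.trans hC')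
      rfl
  | _ => cases h'; rfl

theorem Red.exists_next {M N : Term n} (h : Red m M N) :
    ∃ E R, E.IsEval ∧ M = Ctx.plug E R ∧ Next m E R N := by
  cases h with
  | fail hE => exact ⟨_, _, hE, rfl, .fail⟩
  | @step E _ _ hE h =>
    cases h with
    | beta hV => exact ⟨_, _, hE, rfl, .beta hV⟩
    | iteTrue => exact ⟨_, _, hE, rfl, .iteTrue⟩
    | iteFalse => exact ⟨_, _, hE, rfl, .iteFalse⟩
    | fix => exact ⟨_, _, hE, rfl, .fix⟩
    | ret hV => exact ⟨_, _, hE, rfl, .ret hV⟩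
    | @eff F α V₁ V₂ M₀ H hF hF' h₁ h₂ =>
      exact ⟨E.comp (.handle F M₀ H), .op α V₁ V₂, hE.comp (.handle hF),
        by rw [Ctx.plug_comp, Ctx.plug], .op rfl hF' h₁ h₂⟩

theorem Red.rightUnique : Relator.RightUnique (Red m : Term n → Term n → Prop) := by
  intro M N N' h h'
  obtain ⟨E, R, hE, rfl, hN⟩ := h.exists_next
  obtain ⟨E', R', hE', hM, hN'⟩ := h'.exists_next
  obtain ⟨rfl, rfl⟩ := hN.isPotentialRedex.plug_inj hN'.isPotentialRedex hE hE' hM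
  exact hN.unique hN'

theorem eq_fail_of_red_fail {N : Term n} (h : Red m .fail N) : N = .fail :=
  Red.rightUnique h (.fail (E := .hole) .hole)

theorem eq_fail_of_reflTransGen_fail {N : Term n} (h : Relation.ReflTransGen (Red m) .fail N) :
    N = .fail := by
  induction h with
  | refl => rfl
  | tail _ h ih => exact eq_fail_of_red_fail (ih ▸ h)

theorem not_reaches_of_forall_transGen {P : Term n → Prop} (hfail : ¬ P .fail)
    (hP : ∀ M, P M → ∃ N, P N ∧ Relation.TransGen (Red m) M N) {M : Term n} (hM : P M) :
    ¬ Reaches m M := by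
  intro h
  suffices ∀ N, P N → ¬ Relation.ReflTransGen (Red m) M N from this M hM .refl
  clear hM
  induction h using Relation.ReflTransGen.head_induction_on with
  | refl => exact fun N hN hfN => hfail (eq_fail_of_reflTransGen_fail hfN ▸ hN)
  | head hMM' _ ih =>
    intro N hN hMN
    obtain ⟨N', hN', hNN'⟩ := hP N hN
    obtain ⟨M'', hMM'', hM''N'⟩ := Relation.TransGen.head'_iff.1 (hNN'.trans_right hMN)
    exact ih N' hN' (Red.rightUnique hMM' hMM'' ▸ hM''N')

end Determinism

section Steps

variable {n : ℕ} {m : Mode}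

/-- The reduction steps that do not propagate `fail`: unlike the full reduction relation, they are
preserved by evaluation contexts. -/
inductive Step (m : Mode) : Term n → Term n → Prop
  | mk {E : Ctx n} {M N : Term n} : E.IsEval → Contract m M N → Step m (E.plug M) (E.plug N)

theorem Step.red {M N : Term n} : Step m M N → Red m M N
  | mk hE h => .step hE h

theorem Step.plug {M N : Term n} (h : Step m M N) {E : Ctx n} (hE : E.IsEval) :
    Step m (E.plug M) (E.plug N) := by
  obtain ⟨hE', h⟩ := h
  rw [← Ctx.plug_comp, ← Ctx.plug_comp]
  exact .mk (hE.comp hE') h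

theorem Contract.step {M N : Term n} (h : Contract m M N) : Step m M N :=
  .mk (E := .hole) .hole h

/-- Finitely many reduction steps that do not propagate `fail`. -/
abbrev Steps (m : Mode) : Term n → Term n → Prop := Relation.ReflTransGen (Step m)

theorem Contract.steps {M N : Term n} (h : Contract m M N) : Steps m M N := .single h.step

theorem Steps.beta {M V N : Term n} (hV : IsValue V) (h : M.subst (single V) = N) :
    Steps m (.app (.lam M) V) N :=
  h ▸ (Contract.beta hV).steps

theorem Steps.plug {M N : Term n} (h : Steps m M N) {E : Ctx n} (hE : E.IsEval) :
    Steps m (E.plug M) (E.plug N) :=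
  h.lift _ fun _ _ h => h.plug hE

theorem Steps.appL {M M' : Term n} (h : Steps m M M') (N : Term n) :
    Steps m (.app M N) (.app M' N) :=
  h.plug (E := .appL .hole N) (.appL .hole)

theorem Steps.appR {V N N' : Term n} (hV : IsValue V) (h : Steps m N N') :
    Steps m (.app V N) (.app V N') :=
  h.plug (E := .appR V .hole) (.appR hV .hole)

theorem Steps.ite {M M' : Term n} (h : Steps m M M') (M₁ M₂ : Term n) :
    Steps m (.ite M M₁ M₂) (.ite M' M₁ M₂) :=
  h.plug (E := .ite .hole M₁ M₂) (.ite .hole)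

theorem Steps.handle {M M' : Term n} (h : Steps m M M') (M₀ : Term n) (H : Fin n → Term n) :
    Steps m (.handle M M₀ H) (.handle M' M₀ H) :=
  h.plug (E := .handle .hole M₀ H) (.handle .hole)

theorem Steps.handle_ret {M V : Term n} (h : Steps m M V) (hV : IsValue V) (M₀ : Term n)
    (H : Fin n → Term n) : Steps m (.handle M M₀ H) (M₀.subst (single V)) :=
  (h.handle M₀ H).tail (Contract.ret hV).step

theorem Steps.handle_op {M V₁ V₂ : Term n} {α : Fin n} (h : Steps m M (.op α V₁ V₂))
    (h₁ : IsValue V₁) (h₂ : IsValue V₂) (M₀ : Term n) (H : Fin n → Term n) :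
    Steps m (.handle M M₀ H) ((H α).subst (double (resumption m .hole V₂ M₀ H) V₁)) :=
  (h.handle M₀ H).tail (Contract.eff (F := .hole) .hole trivial h₁ h₂).step

theorem Steps.app_resumption_shallow {V W : Term n} (hW : IsValue W) (M₀ : Term n)
    (H : Fin n → Term n) :
    Steps .shallow (.app (resumption .shallow .hole V M₀ H) W) (.app V W) :=
  .beta hW (by simp only [Ctx.rename, Ctx.plug, subst, rename_succ_subst_single, single_zero])

theorem Steps.app_resumption_deep {V W : Term n} (hW : IsValue W) (M₀ : Term n)
    (H : Fin n → Term n) :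
    Steps .deep (.app (resumption .deep .hole V M₀ H) W) (.handle (.app V W) M₀ H) :=
  .beta hW (by simp only [Ctx.rename, Ctx.plug, subst, subst_rename, liftSub_comp_liftRen,
    single_comp_succ, liftSub_var, subst_var, single_zero])

theorem Steps.reflTransGen_red {M N : Term n} (h : Steps m M N) :
    Relation.ReflTransGen (Red m) M N :=
  Relation.ReflTransGen.mono (fun _ _ => Step.red) _ _ h

end Steps

section Evaluation

variable {n : ℕ} {m : Mode} {P Q : Term n → Prop}

/-- `Evals m M P`: the expression `M` evaluates to a value that satisfies `P`. -/
def Evals (m : Mode) (M : Term n) (P : Term n → Prop) : Prop :=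
  ∃ V, IsValue V ∧ P V ∧ Steps m M V

/-- `Maps m P Q F`: applied to any value that satisfies `P`, the function `F` evaluates to a value
that satisfies `Q`. -/
def Maps (m : Mode) (P Q : Term n → Prop) (F : Term n) : Prop :=
  ∀ V, IsValue V → P V → Evals m (.app F V) Q

theorem Evals.of_isValue {V : Term n} (hV : IsValue V) (h : P V) : Evals m V P := ⟨V, hV, h, .refl⟩

theorem Evals.of_steps {M N : Term n} (h : Steps m M N) (hN : Evals m N P) : Evals m M P :=
  let ⟨V, hV, hP, hs⟩ := hN
  ⟨V, hV, hP, h.trans hs⟩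

theorem Evals.app {F M : Term n} (hF : Evals m F (Maps m P Q)) (hM : Evals m M P) :
    Evals m (.app F M) Q :=
  let ⟨_, hG, hPQ, hFG⟩ := hF
  let ⟨V, hV, hP, hMV⟩ := hM
  .of_steps ((hFG.appL M).trans (hMV.appR hG)) (hPQ V hV hP)

theorem Maps.lam {M : Term n}
    (h : ∀ V, IsValue V → P V → Evals m (M.subst (single V)) Q) : Maps m P Q (.lam M) :=
  fun V hV hP => .of_steps (.beta hV rfl) (h V hV hP)

theorem Evals.lam {M : Term n}
    (h : ∀ V, IsValue V → P V → Evals m (M.subst (single V)) Q) :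
    Evals m (.lam M) (Maps m P Q) :=
  .of_isValue (.lam M) (.lam h)

theorem Evals.fix {M : Term n}
    (h : ∀ V, IsValue V → P V →
      Evals m ((M.subst (liftSub (single (.fix M)))).subst (single V)) Q) :
    Evals m (.fix M) (Maps m P Q) :=
  .of_steps Contract.fix.steps (.lam h)

theorem Evals.ite_of_true {M M₁ M₂ : Term n} (h : Evals m M (· = .tt)) (h₁ : Evals m M₁ P) :
    Evals m (.ite M M₁ M₂) P := by
  obtain ⟨_, _, rfl, hs⟩ := h
  exact .of_steps ((hs.ite M₁ M₂).tail Contract.iteTrue.step) h₁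

theorem Evals.ite_of_false {M M₁ M₂ : Term n} (h : Evals m M (· = .ff)) (h₂ : Evals m M₂ P) :
    Evals m (.ite M M₁ M₂) P := by
  obtain ⟨_, _, rfl, hs⟩ := h
  exact .of_steps ((hs.ite M₁ M₂).tail Contract.iteFalse.step) h₂

end Evaluation

section Naturals

/-- The value that serves as the operand of effects, and as the argument of continuations, of a
base type. -/
def BaseTy.val {n : ℕ} : BaseTy → Term n
  | .unit => .unit
  | .bool => .tt

/-- The type of numbers. -/
def natTy : Ty := .arrow (.base .unit) (.base .unit)

variable {n : ℕ} {m : Mode} {A : Sig n} {α : Fin n}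

theorem BaseTy.isValue_val (b : BaseTy) : IsValue (b.val : Term n) := by
  cases b <;> constructor

theorem BaseTy.hasType_val {Γ : List Ty} (b : BaseTy) : HasType m A Γ b.val (.base b) := by
  cases b <;> constructor

@[simp]
theorem BaseTy.val_subst (b : BaseTy) (s : ℕ → Term n) : b.val.subst s = b.val := by
  cases b <;> rfl

variable (A α)

/-- `Emits A α m k M`: the expression `M` performs the effect `α` exactly `k` times, where each
continuation is resumed with the default argument, and then returns `()`. -/
inductive Emits (m : Mode) : ℕ → Term n → Prop
  | zero {M : Term n} : Steps m M .unit → Emits m 0 M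
  | succ {k : ℕ} {M V : Term n} : Steps m M (.op α (A α).1.val V) → IsValue V →
      Emits m k (.app V (A α).2.val) → Emits m (k + 1) M

/-- The number `k` is represented by a function of type `unit → unit` that performs the effect
`α` exactly `k` times. -/
def RepNat (m : Mode) (k : ℕ) (V : Term n) : Prop :=
  Emits A α m k (.app V .unit)

variable {A α}

theorem Emits.of_steps {k : ℕ} {M N : Term n} (h : Steps m M N) (hN : Emits A α m k N) :
    Emits A α m k M := by
  cases hN with
  | zero hs => exact .zero (h.trans hs)
  | succ hs hV hk => exact .succ (h.trans hs) hV hk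

/-- The number `0`. -/
def natZero : Term n := .lam .unit

variable (A α)

/-- The successor function. -/
def natSucc : Term n :=
  .lam (.lam (.op α (A α).1.val (.lam (.app (.var 2) .unit))))

/-- The numeral of `k`. -/
def numeral : ℕ → Term n
  | 0 => natZero
  | k + 1 => .app (natSucc A α) (numeral k)

/-- The zero test: it handles the first effect of its argument. -/
def natIsZero : Term n :=
  .lam (.handle (.app (.var 0) .unit) .tt fun _ => .ff)

/-- The clauses of a shallow handler that turns an expression of type `unit` into a thunk of the
expression without its first effect. -/
def shallowPredClauses (β : Fin n) : Term n :=
  .lam (.app (.var 1) (A β).2.val)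

/-- The clauses of a deep handler that turns an expression of type `unit` into a function of type
`bool → unit`, whose argument says whether the first effect of the expression is skipped. -/
def deepPredClauses (β : Fin n) : Term n :=
  .lam (.ite (.var 0)
    (.app (.app (.var 1) (A β).2.val) .ff)
    (.op β (A β).1.val (.lam (.app (.app (.var 2) (.var 0)) .ff))))

/-- The predecessor function. -/
def natPred : Mode → Term n
  | .shallow => .lam (.handle (.app (.var 0) .unit) natZero (shallowPredClauses A))
  | .deep =>
      .lam (.lam (.app (.handle (.app (.var 1) .unit) (.lam .unit) (deepPredClauses A)) .tt))

variable {A α}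

theorem hasType_natZero {Γ : List Ty} : HasType m A Γ natZero natTy := .lam .unit

theorem hasType_natSucc {Γ : List Ty} : HasType m A Γ (natSucc A α) (.arrow natTy natTy) :=
  .lam (.lam (.op (.val (BaseTy.isValue_val _)) (.val (.lam _)) (BaseTy.hasType_val _)
    (.lam (.app (.var rfl) .unit))))

theorem hasType_numeral {Γ : List Ty} : ∀ k, HasType m A Γ (numeral A α k) natTy
  | 0 => hasType_natZero
  | k + 1 => .app hasType_natSucc (hasType_numeral k)

theorem hasType_natIsZero {Γ : List Ty} : HasType m A Γ natIsZero (.arrow natTy (.base .bool)) :=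
  .lam (.handle .tt (fun _ => .ff) (.app (.var rfl) .unit))

theorem hasType_shallowPredClauses {Γ : List Ty} (β : Fin n) :
    HasType m A (.arrow (.base (A β).2) (.base .unit) :: .base (A β).1 :: Γ)
      (shallowPredClauses A β) natTy :=
  .lam (.app (.var rfl) (BaseTy.hasType_val _))

theorem hasType_deepPredClauses {Γ : List Ty} (β : Fin n) :
    HasType m A
      (.arrow (.base (A β).2) (.arrow (.base .bool) (.base .unit)) :: .base (A β).1 :: Γ)
      (deepPredClauses A β) (.arrow (.base .bool) (.base .unit)) :=
  .lam (.ite (.var rfl) (.app (.app (.var rfl) (BaseTy.hasType_val _)) .ff)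
    (.op (.val (BaseTy.isValue_val _)) (.val (.lam _)) (BaseTy.hasType_val _)
      (.lam (.app (.app (.var rfl) (.var rfl)) .ff))))

@[simp]
theorem shallowPredClauses_subst (β : Fin n) (s : ℕ → Term n) :
    (shallowPredClauses A β).subst (liftSub (liftSub s)) = shallowPredClauses A β :=
  (hasType_shallowPredClauses (m := .shallow) (Γ := []) β).subst_eq_self
    (liftSub_eq_var (liftSub_eq_var (by simp)))

@[simp]
theorem deepPredClauses_subst (β : Fin n) (s : ℕ → Term n) :
    (deepPredClauses A β).subst (liftSub (liftSub s)) = deepPredClauses A β :=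
  (hasType_deepPredClauses (m := .deep) (Γ := []) β).subst_eq_self
    (liftSub_eq_var (liftSub_eq_var (by simp)))

theorem hasType_natPred {Γ : List Ty} : HasType m A Γ (natPred A m) (.arrow natTy natTy) :=
  match m with
  | .shallow => .lam (.handle hasType_natZero hasType_shallowPredClauses (.app (.var rfl) .unit))
  | .deep => .lam (.lam (.app (.handle (.lam .unit) hasType_deepPredClauses
      (.app (.var rfl) .unit)) .tt))

@[simp]
theorem natZero_subst (s : ℕ → Term n) : natZero.subst s = natZero := rfl

@[simp]
theorem natSucc_subst (s : ℕ → Term n) : (natSucc A α).subst s = natSucc A α :=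
  (hasType_natSucc (m := .shallow)).closed_subst s

@[simp]
theorem numeral_subst (k : ℕ) (s : ℕ → Term n) : (numeral A α k).subst s = numeral A α k :=
  (hasType_numeral (m := .shallow) k).closed_subst s

@[simp]
theorem natIsZero_subst (s : ℕ → Term n) : natIsZero.subst s = natIsZero := rfl

@[simp]
theorem natPred_subst (s : ℕ → Term n) : (natPred A m).subst s = natPred A m :=
  hasType_natPred.closed_subst s

theorem repNat_natZero : RepNat A α m 0 natZero := .zero (.beta .unit rfl)

theorem evals_natSucc (k : ℕ) :
    Evals m (natSucc A α) (Maps m (RepNat A α m k) (RepNat A α m (k + 1))) := by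
  refine .lam fun V _ hk => .of_isValue (.lam _) ?_
  refine .succ (V := .lam (.app (V.rename Nat.succ) .unit)) (.beta .unit ?_) (.lam _) ?_
  · simp [subst]
  · exact .of_steps (.beta (BaseTy.isValue_val _) (by simp [subst])) hk

theorem evals_numeral : ∀ k, Evals m (numeral A α k) (RepNat A α m k)
  | 0 => .of_isValue (.lam _) repNat_natZero
  | k + 1 => .app (evals_natSucc k) (evals_numeral k)

theorem evals_natIsZero_zero : Evals m natIsZero (Maps m (RepNat A α m 0) (· = .tt)) := by
  refine .lam fun V _ hk => ?_
  cases hk with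
  | zero h => exact .of_steps (h.handle_ret .unit _ _) (.of_isValue .tt rfl)

theorem evals_natIsZero_succ (k : ℕ) :
    Evals m natIsZero (Maps m (RepNat A α m (k + 1)) (· = .ff)) := by
  refine .lam fun V _ hk => ?_
  cases hk with
  | succ h hW =>
    exact .of_steps (h.handle_op (BaseTy.isValue_val _) hW _ _) (.of_isValue .ff rfl)

theorem Emits.app_handle_deepPredClauses {k : ℕ} {M : Term n} (h : Emits A α .deep k M) :
    Emits A α .deep k (.app (.handle M (.lam .unit) (deepPredClauses A)) .ff) := by
  induction h with
  | zero h =>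
    exact .zero (((h.handle_ret .unit _ _).appL _).trans (Steps.beta .ff rfl))
  | @succ k M V h hV _ ih =>
    let K : Term n := resumption .deep .hole V (.lam .unit) (deepPredClauses A)
    refine .succ (V := .lam (.app (.app (K.rename Nat.succ) (var 0)) .ff)) ?_ (.lam _) ?_
    · refine ((h.handle_op (BaseTy.isValue_val _) hV _ _).appL _).trans ?_
      exact (Steps.beta .ff rfl).tail (by simpa [subst] using Contract.iteFalse.step)
    · refine .of_steps (.beta (BaseTy.isValue_val _) rfl) (.of_steps ?_ ih)
      simp only [subst, rename_succ_subst_single]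
      exact (Steps.app_resumption_deep (BaseTy.isValue_val _) _ _).appL _

theorem evals_natPred_succ (k : ℕ) :
    Evals m (natPred A m) (Maps m (RepNat A α m (k + 1)) (RepNat A α m k)) := by
  cases m with
  | shallow =>
    refine .lam fun V _ hk => ?_
    cases hk with
    | succ h hW hk =>
      simp only [subst, single_zero, shallowPredClauses_subst]
      refine .of_steps (h.handle_op (BaseTy.isValue_val _) hW _ _)
        (.of_isValue (.lam _) (.of_steps (.beta .unit rfl) ?_))
      refine .of_steps ?_ hk
      simp only [subst, liftSub_one, double_zero, rename_succ_subst_single, BaseTy.val_subst]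
      exact Steps.app_resumption_shallow (BaseTy.isValue_val _) _ _
  | deep =>
    refine .lam fun V _ hk => .of_isValue (.lam _) (.of_steps (.beta .unit rfl) ?_)
    cases hk with
    | succ h hW hk =>
      simp only [subst, liftSub_one, single_zero, rename_succ_subst_single, deepPredClauses_subst]
      refine .of_steps ((h.handle_op (BaseTy.isValue_val _) hW _ _).appL _) ?_
      refine .of_steps (Steps.beta .tt rfl) (.of_steps Contract.iteTrue.steps ?_)
      refine .of_steps ?_ hk.app_handle_deepPredClauses
      simp only [subst, liftSub_one, double_zero, rename_succ_subst_single, BaseTy.val_subst]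
      exact (Steps.app_resumption_deep (BaseTy.isValue_val _) _ _).appL _

end Naturals

section Vectors

/-- The type of vectors of numbers, which are represented by functions from indices to entries. -/
def vecTy : Ty := .arrow natTy natTy

/-- The empty vector. It has no entries, so any function from numbers to numbers represents it. -/
def vecNil {n : ℕ} : Term n := .lam (.var 0)

variable {n : ℕ} {m : Mode} (A : Sig n) (α : Fin n)

variable (m) in
/-- The function that adds an entry at the front of a vector. -/
def vecCons : Term n :=
  .lam (.lam (.lam (.ite (.app natIsZero (.var 0)) (.var 2)
    (.app (.var 1) (.app (natPred A m) (.var 0))))))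

/-- The function that removes the first entry of a vector. -/
def vecTail : Term n :=
  .lam (.lam (.app (.var 1) (.app (natSucc A α) (.var 0))))

/-- The vector `v` is represented by a function that maps each index of `v` to the entry there. -/
def RepVec {k : ℕ} (m : Mode) (v : List.Vector ℕ k) (V : Term n) : Prop :=
  ∀ i : Fin k, Maps m (RepNat A α m i) (RepNat A α m (v.get i)) V

variable {A α}

theorem hasType_vecNil {Γ : List Ty} : HasType m A Γ vecNil vecTy := .lam (.var rfl)

theorem hasType_vecCons {Γ : List Ty} :
    HasType m A Γ (vecCons m A) (.arrow natTy (.arrow vecTy vecTy)) :=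
  .lam (.lam (.lam (.ite (.app hasType_natIsZero (.var rfl)) (.var rfl)
    (.app (.var rfl) (.app hasType_natPred (.var rfl))))))

theorem hasType_vecTail {Γ : List Ty} : HasType m A Γ (vecTail A α) (.arrow vecTy vecTy) :=
  .lam (.lam (.app (.var rfl) (.app hasType_natSucc (.var rfl))))

@[simp]
theorem vecNil_subst (s : ℕ → Term n) : vecNil.subst s = vecNil := rfl

@[simp]
theorem vecCons_subst (s : ℕ → Term n) : (vecCons m A).subst s = vecCons m A :=
  hasType_vecCons.closed_subst s

@[simp]
theorem vecTail_subst (s : ℕ → Term n) : (vecTail A α).subst s = vecTail A α :=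
  (hasType_vecTail (m := .shallow)).closed_subst s

theorem repVec_nil (V : Term n) : RepVec A α m .nil V := fun i => i.elim0

theorem evals_app_numeral {k : ℕ} {v : List.Vector ℕ k} {R : Term n} (hR : IsValue R)
    (hv : RepVec A α m v R) (i : Fin k) :
    Evals m (.app R (numeral A α i)) (RepNat A α m (v.get i)) :=
  .app (.of_isValue hR (hv i)) (evals_numeral i)

theorem evals_app_natZero {k : ℕ} {v : List.Vector ℕ (k + 1)} {R : Term n} (hR : IsValue R)
    (hv : RepVec A α m v R) : Evals m (.app R natZero) (RepNat A α m v.head) :=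
  v.get_zero ▸ evals_app_numeral hR hv 0

theorem evals_vecCons {k : ℕ} (a : ℕ) (v : List.Vector ℕ k) :
    Evals m (vecCons m A)
      (Maps m (RepNat A α m a) (Maps m (RepVec A α m v) (RepVec A α m (a ::ᵥ v)))) := by
  refine .lam fun X hX ha => .lam fun R hR hv => .of_isValue (.lam _) fun i =>
    .lam fun I hI hi => ?_
  simp only [subst, rename, natIsZero_subst, natPred_subst, liftSub_zero, liftSub_one, liftSub_two,
    single_zero, rename_succ_subst_single, rename_succ_succ_subst_liftSub_single]
  cases i using Fin.cases with
  | zero =>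
    rw [List.Vector.get_cons_zero]
    exact .ite_of_true (evals_natIsZero_zero.app (.of_isValue hI hi)) (.of_isValue hX ha)
  | succ i =>
    rw [List.Vector.get_cons_succ]
    exact .ite_of_false ((evals_natIsZero_succ i).app (.of_isValue hI hi))
      (.app (.of_isValue hR (hv i)) ((evals_natPred_succ i).app (.of_isValue hI hi)))

theorem evals_vecTail {k : ℕ} (v : List.Vector ℕ (k + 1)) :
    Evals m (vecTail A α) (Maps m (RepVec A α m v) (RepVec A α m v.tail)) := by
  refine .lam fun R hR hv => .of_isValue (.lam _) fun i => .lam fun I hI hi => ?_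
  rw [List.Vector.get_tail_succ]
  simpa [subst] using
    Evals.app (.of_isValue hR (hv i.succ)) ((evals_natSucc i).app (.of_isValue hI hi))

/-- `Realizes m A α f F`: the closed function `F` on representations of vectors computes `f`. -/
structure Realizes (m : Mode) (A : Sig n) (α : Fin n) {k : ℕ} (f : List.Vector ℕ k → ℕ)
    (F : Term n) : Prop where
  hasType : HasType m A [] F (.arrow vecTy natTy)
  evals (v : List.Vector ℕ k) : Evals m F (Maps m (RepVec A α m v) (RepNat A α m (f v)))

theorem Realizes.closed_subst {k : ℕ} {f : List.Vector ℕ k → ℕ} {F : Term n}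
    (hF : Realizes m A α f F) (s : ℕ → Term n) : F.subst s = F :=
  hF.hasType.closed_subst s

end Vectors

section PrimitiveRecursion

variable {n : ℕ} {m : Mode} {A : Sig n} {α : Fin n}

theorem Realizes.zero : Realizes m A α (fun _ : List.Vector ℕ 0 => 0) (.lam natZero) where
  hasType := .lam hasType_natZero
  evals _ := .lam fun _ _ _ => .of_isValue (.lam _) repNat_natZero

theorem Realizes.succ : Realizes m A α (fun v : List.Vector ℕ 1 => v.head.succ)
    (.lam (.app (natSucc A α) (.app (.var 0) natZero))) where
  hasType := .lam (.app hasType_natSucc (.app (.var rfl) hasType_natZero))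
  evals v := .lam fun R hR hv => by
    simpa [subst] using (evals_natSucc v.head).app (evals_app_natZero hR hv)

theorem Realizes.get {k : ℕ} (i : Fin k) :
    Realizes m A α (fun v => v.get i) (.lam (.app (.var 0) (numeral A α i))) where
  hasType := .lam (.app (.var rfl) (hasType_numeral i))
  evals v := .lam fun R hR hv => by simpa [subst] using evals_app_numeral hR hv i

variable (m A) in
/-- The vector with entries `G i ρ`, where `ρ` is the variable with index `0`. -/
def tuple : {k : ℕ} → (Fin k → Term n) → Term n
  | 0, _ => vecNil
  | _ + 1, G => .app (.app (vecCons m A) (.app (G 0) (.var 0))) (tuple fun i => G i.succ)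

theorem hasType_tuple {k : ℕ} {G : Fin k → Term n} {Γ : List Ty}
    (hG : ∀ i, HasType m A [] (G i) (.arrow vecTy natTy)) :
    HasType m A (vecTy :: Γ) (tuple m A G) vecTy := by
  induction k with
  | zero => exact hasType_vecNil
  | succ k ih =>
    exact .app (.app hasType_vecCons (.app ((hG 0).weaken _) (.var rfl))) (ih fun i => hG i.succ)

theorem evals_tuple {j k : ℕ} {g : Fin k → List.Vector ℕ j → ℕ} {G : Fin k → Term n}
    (hG : ∀ i, Realizes m A α (g i) (G i)) {v : List.Vector ℕ j} {R : Term n} (hR : IsValue R)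
    (hv : RepVec A α m v R) :
    Evals m ((tuple m A G).subst (single R)) (RepVec A α m (.ofFn fun i => g i v)) := by
  induction k with
  | zero => exact .of_isValue (.lam _) (repVec_nil _)
  | succ k ih =>
    have hhead := ((hG 0).evals v).app (.of_isValue hR hv)
    have htail := ih fun i => hG i.succ
    change Evals m _ (RepVec A α m (g 0 v ::ᵥ .ofFn fun i => g i.succ v))
    simpa [tuple, subst, (hG 0).closed_subst] using ((evals_vecCons _ _).app hhead).app htail

theorem Realizes.comp {j k : ℕ} {f : List.Vector ℕ k → ℕ} {g : Fin k → List.Vector ℕ j → ℕ}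
    {F : Term n} {G : Fin k → Term n} (hF : Realizes m A α f F)
    (hG : ∀ i, Realizes m A α (g i) (G i)) :
    Realizes m A α (fun v => f (.ofFn fun i => g i v)) (.lam (.app F (tuple m A G))) where
  hasType := .lam (.app (hF.hasType.weaken _) (hasType_tuple fun i => (hG i).hasType))
  evals v := .lam fun R hR hv => by
    simpa [subst, hF.closed_subst] using (hF.evals _).app (evals_tuple hG hR hv)

variable (m A α) in
/-- The recursive function that maps `k` to the value at `k ::ᵥ v` of the function defined by
primitive recursion from the functions that `F` and `G` compute, where `R` represents a vector with
tail `v`. The indices of `R` count the two binders of the recursive function. -/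
def precLoop (F G R : Term n) : Term n :=
  .fix (.ite (.app natIsZero (.var 0)) (.app F (.app (vecTail A α) R))
    (.app G (.app (.app (vecCons m A) (.app (natPred A m) (.var 0)))
      (.app (.app (vecCons m A) (.app (.var 1) (.app (natPred A m) (.var 0))))
        (.app (vecTail A α) R)))))

theorem hasType_precLoop {F G R : Term n} {Γ : List Ty}
    (hF : HasType m A [] F (.arrow vecTy natTy)) (hG : HasType m A [] G (.arrow vecTy natTy))
    (hR : HasType m A (natTy :: .arrow natTy natTy :: Γ) R vecTy) :
    HasType m A Γ (precLoop m A α F G R) (.arrow natTy natTy) := by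
  have hpred : HasType m A (natTy :: .arrow natTy natTy :: Γ)
    (.app (natPred A m) (.var 0)) natTy := .app hasType_natPred (.var rfl)
  have htail := HasType.app (hasType_vecTail (α := α)) hR
  exact .fix (.ite (.app hasType_natIsZero (.var rfl)) (.app (hF.weaken _) htail)
    (.app (hG.weaken _) (.app (.app hasType_vecCons hpred)
      (.app (.app hasType_vecCons (.app (.var rfl) hpred)) htail))))

theorem evals_precLoop {j : ℕ} {f : List.Vector ℕ j → ℕ} {g : List.Vector ℕ (j + 2) → ℕ}
    {F G : Term n} (hF : Realizes m A α f F) (hG : Realizes m A α g G)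
    {v : List.Vector ℕ (j + 1)} {R : Term n} (hR : IsValue R) (hv : RepVec A α m v R) (k : ℕ) :
    Evals m (precLoop m A α F G ((R.rename Nat.succ).rename Nat.succ)) (Maps m (RepNat A α m k)
      (RepNat A α m (k.rec (f v.tail) fun y IH => g (y ::ᵥ IH ::ᵥ v.tail)))) := by
  have htail := (evals_vecTail v).app (.of_isValue hR hv)
  induction k with
  | zero =>
    refine .fix fun V hV hk => ?_
    simpa [subst, hF.closed_subst, hG.closed_subst] using
      Evals.ite_of_true (evals_natIsZero_zero.app (.of_isValue hV hk)) ((hF.evals _).app htail)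
  | succ k ih =>
    refine .fix fun V hV hk => ?_
    simp only [subst, natIsZero_subst, natPred_subst, vecCons_subst, vecTail_subst,
      hF.closed_subst, hG.closed_subst, liftSub_zero, liftSub_one, single_zero,
      rename_succ_subst_single, rename_succ_succ_subst_liftSub_single]
    have hpred := (evals_natPred_succ k).app (.of_isValue hV hk)
    exact .ite_of_false ((evals_natIsZero_succ k).app (.of_isValue hV hk)) ((hG.evals _).app
      (((evals_vecCons _ _).app hpred).app (((evals_vecCons _ _).app (ih.app hpred)).app htail)))

theorem Realizes.prec {j : ℕ} {f : List.Vector ℕ j → ℕ} {g : List.Vector ℕ (j + 2) → ℕ}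
    {F G : Term n} (hF : Realizes m A α f F) (hG : Realizes m A α g G) :
    Realizes m A α (fun v : List.Vector ℕ (j + 1) =>
        v.head.rec (f v.tail) fun y IH => g (y ::ᵥ IH ::ᵥ v.tail))
      (.lam (.app (precLoop m A α F G (.var 2)) (.app (.var 0) natZero))) where
  hasType := .lam (.app (hasType_precLoop hF.hasType hG.hasType (.var rfl))
    (.app (.var rfl) hasType_natZero))
  evals v := .lam fun R hR hv => by
    simpa [subst, rename, precLoop, hF.closed_subst, hG.closed_subst] using
      (evals_precLoop hF hG hR hv v.head).app (evals_app_natZero hR hv)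

variable (m A α) in
theorem exists_realizes {k : ℕ} {f : List.Vector ℕ k → ℕ} (hf : Nat.Primrec' f) :
    ∃ F, Realizes m A α f F := by
  induction hf with
  | zero => exact ⟨_, .zero⟩
  | succ => exact ⟨_, .succ⟩
  | get i => exact ⟨_, .get i⟩
  | comp g _ _ ihf ihg =>
    obtain ⟨F, hF⟩ := ihf
    choose G hG using ihg
    exact ⟨_, hF.comp hG⟩
  | prec _ _ ihf ihg =>
    obtain ⟨F, hF⟩ := ihf
    obtain ⟨G, hG⟩ := ihg
    exact ⟨_, hF.prec hG⟩

end PrimitiveRecursion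

section Search

variable {n : ℕ} {m : Mode} {A : Sig n} {α : Fin n}

variable (m A α) in
/-- The recursive function that, applied to `s` and `k`, looks for the least `s' ≥ s` such that the
function computed by `G` vanishes at `(s', k)`, and fails if it finds one. -/
def search (G : Term n) : Term n :=
  .fix (.lam (.ite
    (.app natIsZero (.app G (.app (.app (vecCons m A) (.var 1))
      (.app (.app (vecCons m A) (.var 0)) vecNil))))
    .fail (.app (.app (.var 2) (.app (natSucc A α) (.var 1))) (.var 0))))

theorem hasType_search {G : Term n} (hG : HasType m A [] G (.arrow vecTy natTy)) :
    HasType m A [] (search m A α G) (.arrow natTy (.arrow natTy (.base .unit))) :=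
  .fix (.lam (.ite
    (.app hasType_natIsZero (.app (hG.weaken _) (.app (.app hasType_vecCons (.var rfl))
      (.app (.app hasType_vecCons (.var rfl)) hasType_vecNil))))
    .fail (.app (.app (.var rfl) (.app hasType_natSucc (.var rfl))) (.var rfl))))

theorem transGen_search {g : List.Vector ℕ 2 → ℕ} {G S K : Term n} (hG : Realizes m A α g G)
    {s k : ℕ} (hS : Evals m S (RepNat A α m s)) (hK : Evals m K (RepNat A α m k)) :
    ∃ T V W, Evals m T (RepNat A α m (g (s ::ᵥ k ::ᵥ .nil))) ∧
      Evals m V (RepNat A α m (s + 1)) ∧ Evals m W (RepNat A α m k) ∧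
      Relation.TransGen (Red m) (.app (.app (search m A α G) S) K)
        (.ite (.app natIsZero T) .fail (.app (.app (search m A α G) V) W)) := by
  obtain ⟨V, hV, hVs, hSV⟩ := hS
  obtain ⟨W, hW, hWk, hKW⟩ := hK
  have hs : Evals m V (RepNat A α m s) := .of_isValue hV hVs
  have hk : Evals m W (RepNat A α m k) := .of_isValue hW hWk
  have hnil : Evals m vecNil (RepVec A α m .nil) := .of_isValue (.lam _) (repVec_nil _)
  have hvec := ((evals_vecCons s _).app hs).app (((evals_vecCons k _).app hk).app hnil)
  refine ⟨_, _, W, (hG.evals _).app hvec, (evals_natSucc s).app hs, hk, .head'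
    (Contract.fix.step.plug (E := .appL (.appL .hole S) K) (.appL (.appL .hole))).red
    (Steps.reflTransGen_red ?_)⟩
  refine (Steps.appL ((Steps.appR (.lam _) hSV).trans (Steps.beta hV rfl)) K).trans
    ((Steps.appR (.lam _) hKW).trans (Steps.beta hW ?_))
  rw [← search]
  simp [subst, rename, hG.closed_subst]

theorem reaches_search_of_eq_zero {g : List.Vector ℕ 2 → ℕ} {G S K : Term n}
    (hG : Realizes m A α g G) {s k : ℕ} (hS : Evals m S (RepNat A α m s))
    (hK : Evals m K (RepNat A α m k)) (h : g (s ::ᵥ k ::ᵥ .nil) = 0) :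
    Reaches m (.app (.app (search m A α G) S) K) := by
  obtain ⟨T, V, W, hT, -, -, hsteps⟩ := transGen_search hG hS hK
  obtain ⟨_, -, rfl, htest⟩ := evals_natIsZero_zero.app (h ▸ hT)
  exact hsteps.to_reflTransGen.trans
    (Steps.reflTransGen_red ((htest.ite _ _).tail Contract.iteTrue.step))

theorem transGen_search_of_ne_zero {g : List.Vector ℕ 2 → ℕ} {G S K : Term n}
    (hG : Realizes m A α g G) {s k : ℕ} (hS : Evals m S (RepNat A α m s))
    (hK : Evals m K (RepNat A α m k)) (h : g (s ::ᵥ k ::ᵥ .nil) ≠ 0) :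
    ∃ V W, Evals m V (RepNat A α m (s + 1)) ∧ Evals m W (RepNat A α m k) ∧
      Relation.TransGen (Red m) (.app (.app (search m A α G) S) K)
        (.app (.app (search m A α G) V) W) := by
  obtain ⟨T, V, W, hT, hV, hW, hsteps⟩ := transGen_search hG hS hK
  obtain ⟨t, ht⟩ := Nat.exists_eq_succ_of_ne_zero h
  obtain ⟨_, -, rfl, htest⟩ := (evals_natIsZero_succ t).app (ht ▸ hT)
  exact ⟨V, W, hV, hW, hsteps.trans_left
    (Steps.reflTransGen_red ((htest.ite _ _).tail Contract.iteFalse.step))⟩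

theorem reaches_search_of_add_eq_zero {g : List.Vector ℕ 2 → ℕ} {G S K : Term n}
    (hG : Realizes m A α g G) {s k : ℕ} (hS : Evals m S (RepNat A α m s))
    (hK : Evals m K (RepNat A α m k)) (d : ℕ) (h : g ((s + d) ::ᵥ k ::ᵥ .nil) = 0) :
    Reaches m (.app (.app (search m A α G) S) K) := by
  induction d generalizing s S K with
  | zero => exact reaches_search_of_eq_zero hG hS hK h
  | succ d ih =>
    by_cases hs : g (s ::ᵥ k ::ᵥ .nil) = 0
    · exact reaches_search_of_eq_zero hG hS hK hs
    · obtain ⟨V, W, hV, hW, hsteps⟩ := transGen_search_of_ne_zero hG hS hK hs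
      exact hsteps.to_reflTransGen.trans (ih hV hW (by rwa [Nat.succ_add_eq_add_succ]))

theorem reaches_search_iff {g : List.Vector ℕ 2 → ℕ} {G S K : Term n} (hG : Realizes m A α g G)
    {k : ℕ} (hS : Evals m S (RepNat A α m 0)) (hK : Evals m K (RepNat A α m k)) :
    Reaches m (.app (.app (search m A α G) S) K) ↔ ∃ s, g (s ::ᵥ k ::ᵥ .nil) = 0 := by
  refine ⟨fun h => ?_,
    fun ⟨s, hs⟩ => reaches_search_of_add_eq_zero hG hS hK s (by rwa [zero_add])⟩
  by_contra! hg
  refine not_reaches_of_forall_transGen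
    (P := fun M => ∃ s S K, Evals m S (RepNat A α m s) ∧ Evals m K (RepNat A α m k) ∧
      M = .app (.app (search m A α G) S) K) (by simp) ?_ ⟨0, S, K, hS, hK, rfl⟩ h
  rintro _ ⟨s, S, K, hS, hK, rfl⟩
  obtain ⟨V, W, hV, hW, hsteps⟩ := transGen_search_of_ne_zero hG hS hK (hg s)
  exact ⟨_, ⟨s + 1, V, W, hV, hW, rfl⟩, hsteps⟩

end Search

section Undecidability

theorem exists_primrec'_not_computablePred_exists_eq_zero :
    ∃ g : List.Vector ℕ 2 → ℕ, Nat.Primrec' g ∧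
      ¬ ComputablePred fun k => ∃ s, g (s ::ᵥ k ::ᵥ .nil) = 0 := by
  let g (s k : ℕ) : ℕ :=
    if (Nat.Partrec.Code.evaln s (Denumerable.ofNat Nat.Partrec.Code k) 0).isSome then 0 else 1
  have hg : Primrec₂ g :=
    Primrec.ite (Primrec.eq.comp (Primrec.option_isSome.comp
      (Nat.Partrec.Code.primrec_evaln.comp ((Primrec.fst.pair
        ((Primrec.ofNat _).comp .snd)).pair (.const 0)))) (.const true)) (.const 0) (.const 1)
  refine ⟨fun v => g v.head v.tail.head, Nat.Primrec'.prim_iff₂.2 hg, fun ⟨_, h⟩ =>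
    ComputablePred.halting_problem 0 ⟨Classical.decPred _, ?_⟩⟩
  refine (h.comp Computable.encode).of_eq fun c => ?_
  simpa [g, Part.dom_iff_mem, Nat.Partrec.Code.evaln_complete, Option.isSome_iff_exists] using
    exists_comm

theorem primrec_code_numeral {n : ℕ} (A : Sig n) (α : Fin n) :
    Primrec fun k => (numeral A α k).code := by
  have hsucc : Primrec₂ fun (_ c : ℕ) => Nat.pair 6 (Nat.pair (natSucc A α).code c) :=
    Primrec₂.natPair.comp (.const _) (Primrec₂.natPair.comp (.const _) .snd)
  refine (Primrec.nat_rec₁ (natZero : Term n).code hsucc).of_eq fun k => ?_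
  induction k with
  | zero => rfl
  | succ k ih => rw [numeral, Term.code, ← ih]

end Undecidability

end BPCFAE

open BPCFAE in
theorem mainTheorem6_general {n : ℕ} (hn : 0 < n) (m : Mode) (A : Sig n) :
    ¬ ReachabilityDecidable m A := by
  rintro ⟨f, hf, hfM⟩
  let α : Fin n := ⟨0, hn⟩
  obtain ⟨g, hg, hundec⟩ := exists_primrec'_not_computablePred_exists_eq_zero
  obtain ⟨G, hG⟩ := exists_realizes m A α hg
  let program (k : ℕ) : Term n := .app (.app (search m A α G) natZero) (numeral A α k)
  have hprogram (k : ℕ) : Reaches m (program k) ↔ ∃ s, g (s ::ᵥ k ::ᵥ .nil) = 0 :=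
    reaches_search_iff hG (evals_numeral 0) (evals_numeral k)
  have hcode : Computable fun k => (program k).code :=
    (Primrec₂.natPair.comp (.const _)
      (Primrec₂.natPair.comp (.const _) (primrec_code_numeral A α))).to_comp
  refine hundec ⟨Classical.decPred _, (hf.comp hcode).of_eq_tot fun k => ?_⟩
  obtain ⟨r, hr, hrk⟩ := hfM (program k)
    ⟨.unit, .app (.app (hasType_search hG.hasType) hasType_natZero) (hasType_numeral k)⟩
  convert hr
  rw [← Bool.coe_iff_coe, hrk, hprogram]
  simp

theorem mainTheorem6 :
    (∀ (n : ℕ) (A : BPCFAE.Sig n),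
      (∃ αZ αS : Fin n, [αZ, αS].Nodup ∧
        ∀ α ∈ [αZ, αS], A α = (BPCFAE.BaseTy.unit, BPCFAE.BaseTy.unit)) →
      ¬ BPCFAE.ReachabilityDecidable BPCFAE.Mode.shallow A) ∧
    (∀ (n : ℕ) (A : BPCFAE.Sig n),
      (∃ αZ αS αZ' αS' : Fin n, [αZ, αS, αZ', αS'].Nodup ∧
        ∀ α ∈ [αZ, αS, αZ', αS'], A α = (BPCFAE.BaseTy.unit, BPCFAE.BaseTy.unit)) →
      ¬ BPCFAE.ReachabilityDecidable BPCFAE.Mode.deep A) :=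
  ⟨fun _ A ⟨αZ, _⟩ => mainTheorem6_general αZ.pos .shallow A,
    fun _ A ⟨αZ, _⟩ => mainTheorem6_general αZ.pos .deep A⟩
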